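/- Let $E=(E^0,E^1,r,s)$ be a countable, nonempty directed graph without sinks that is locally finite: every vertex emits at least one edge, and emits and receives only finitely many edges. Let $X$ be the space of infinite paths $x=x_1x_2\cdots$ of $E$ (edges with $s(x_{i+1})=r(x_i)$) with the cylinder-set topology, and let $\sigma(x_1x_2x_3\cdots)=x_2x_3\cdots$ be the shift; $(X,\sigma)$ is the Deaconu–Renault system of $E$ (here $\mathrm{Dom}(\sigma)=X$). Let $\mathcal G^0$ be the smallest family of sets of vertices that contains all singletons and is closed under finite unions and nonempty finite intersections, let $\mathfrak p$ be the set of finite paths of $E$, the paths of length $0$ being the elements of $\mathcal G^0$, and fix an enumeration $\mathfrak p=\{p_1,p_2,\dots\}$. Here $A\in\mathcal G^0$ is an initial segment of $x\in X$ if $s(x_1)\in A$, and a path of length $k\ge 1$ is an initial segment of $x$ if it equals $x_1\cdots x_k$. Equip $X$ with the metric $d_X(x,y)=2^{-i}$ for $x\neq y$, where $i$ is the least index such that $p_i$ is an initial segment of exactly one of $x,y$; this metric induces the topology of $X$. For a Deaconu–Renault system $(X,\sigma)$ on a metric space $(X,d)$ let $d_n(x,y)$ be the maximum of $d(\sigma^i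 x,\sigma^i y)$ over those $0\le i\le n-1$ with $x,y\in \mathrm{Dom}(\sigma^i)$. For compact $K\subseteq X$ let $\mathrm{ssep}(n,\varepsilon,\sigma,K)$ be the supremum, over the closed sets $F\subseteq \mathrm{Dom}(\sigma^{n-1})$, of the largest cardinality of a subset of $K\cap F$ whose distinct points have $d_n$-distance $>\varepsilon$. The metric entropy is $$h_d(\sigma)=\sup_{K\ \mathrm{compact}}\ \lim_{\varepsilon\to 0}\ \limsup_{n\to\infty}\frac1n\log \mathrm{ssep}(n,\varepsilon,\sigma,K).$$ For compact $K\subseteq X$ and a cover $\alpha$ of $K$ by open sets of $X$, let $\alpha_n=\alpha\vee\sigma^{-1}(\alpha)\vee\cdots\vee\sigma^{-n}(\alpha)$ and $K_n=K\cap\sigma^{-1}(K)\cap\cdots\cap\sigma^{-n}(K)$, and let $N(\alpha_n,K_n)$ be the smallest cardinality of a subfamily of $\alpha_n$ that covers $K_n$ (read as $1$ if $K_n=\emptyset$). The topological (cover) entropy is $$h(\sigma)=\sup_{K\ \mathrm{compact}}\ \sup_{\alpha}\ \lim_{n\to\infty}\frac1n\log N(\alpha_n,K_n).$$ Then the metric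 entropy of $E$ with respect to $d_X$, for any enumeration of $\mathfrak p$, and the topological entropy of $E$ coincide: $h_{d_X}(\sigma)=h(\sigma)$. -/

import Mathlib

open Set Filter Topology
open scoped ENNReal NNReal

noncomputable section

/-! ## Deaconu–Renault systems -/

/-- A Deaconu–Renault system: a locally compact Hausdorff space `X` with a local homeomorphism
`σ : Dom(σ) → Im(σ)` between open subsets of `X`. The map is recorded as a total function, whose
values outside `dom` are never used. (The image of a local homeomorphism on an open set is
automatically open.) -/
structure DeaconuRenault (X : Type*) [TopologicalSpace X] where
  t2 : T2Space X
  locallyCompact : LocallyCompactSpace X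
  dom : Set X
  isOpen_dom : IsOpen dom
  map : X → X
  isLocalHomeomorphOn : IsLocalHomeomorphOn map dom

namespace DeaconuRenault

section Topological

variable {X : Type*} [TopologicalSpace X] (S : DeaconuRenault X)

/-- `Dom(σ^n)`, with `Dom(σ^0) = X` and `Dom(σ^(n+1)) = σ⁻¹(Dom(σ^n))`. -/
def domIter : ℕ → Set X
  | 0 => univ
  | n + 1 => S.dom ∩ S.map ⁻¹' domIter n

/-- `σ^{-i}(A) = {x ∈ Dom(σ^i) : σ^i(x) ∈ A}`. -/
def preim (i : ℕ) (A : Set X) : Set X :=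
  S.domIter i ∩ S.map^[i] ⁻¹' A

/-! ### Entropy via open covers -/

/-- The join of two covers. -/
def join (α β : Set (Set X)) : Set (Set X) :=
  {C | ∃ A ∈ α, ∃ B ∈ β, C = A ∩ B}

/-- `α_n = α ∨ σ⁻¹(α) ∨ ⋯ ∨ σ^{-n}(α)`. -/
def coverIter (α : Set (Set X)) : ℕ → Set (Set X)
  | 0 => α
  | n + 1 => join (coverIter α n) (S.preim (n + 1) '' α)

/-- `Y_n = Y ∩ σ⁻¹(Y) ∩ ⋯ ∩ σ^{-n}(Y)`. -/
def setIter (Y : Set X) : ℕ → Set X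
  | 0 => Y
  | n + 1 => setIter Y n ∩ S.preim (n + 1) Y

/-- `N(α, Y)`: the smallest cardinality of a subfamily of `α` covering `Y`, with the convention
that it is `1` when `Y` is empty (for nonempty `Y` the infimum below is at least `1`). -/
def coverNumber (α : Set (Set X)) (Y : Set X) : ℕ∞ :=
  max 1 (⨅ (β : Set (Set X)) (_ : β ⊆ α ∧ Y ⊆ ⋃₀ β), β.encard)

/-- `H(α, Y) = log N(α, Y)`, with `log ∞ = ∞`. -/
def coverH (α : Set (Set X)) (Y : Set X) : EReal :=
  ENNReal.log (coverNumber α Y : ℝ≥0∞)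

/-- `α` is a cover of `K` by open subsets of `X`. -/
def IsOpenCover (α : Set (Set X)) (K : Set X) : Prop :=
  (∀ A ∈ α, IsOpen A) ∧ K ⊆ ⋃₀ α

/-- `h(α, σ, K) = lim (1/n) H(α_n, K_n)`. The limit exists for compact `K` and open covers `α`
(subadditivity), so it is the upper limit. -/
def entropyCover (α : Set (Set X)) (K : Set X) : EReal :=
  limsup (fun n : ℕ => coverH (S.coverIter α n) (S.setIter K n) / (n : EReal)) atTop

/-- `h(σ, K)`: the supremum of `h(α, σ, K)` over the open covers `α` of `K`. -/
def topologicalEntropyOn (K : Set X) : EReal :=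
  ⨆ (α : Set (Set X)) (_ : IsOpenCover α K), S.entropyCover α K

/-- The topological entropy `h(σ)`: the supremum of `h(σ, K)` over the compact `K ⊆ X`. -/
def topologicalEntropy : EReal :=
  ⨆ (K : Set X) (_ : IsCompact K), S.topologicalEntropyOn K

end Topological

/-! ### Metric entropy via separated sets -/

section Metric

variable {X : Type*} [MetricSpace X] (S : DeaconuRenault X)

open scoped Classical in
/-- `I_n(x) = {i ∈ {0, …, n-1} : x ∈ Dom(σ^i)}`. -/
def timeSet (n : ℕ) (x : X) : Finset ℕ :=
  (Finset.range n).filter fun i => x ∈ S.domIter i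

/-- `d_n(x, y)`: the maximum of `d(σ^i x, σ^i y)` over `i ∈ I_n(x) ∩ I_n(y)`. -/
def iterDist (n : ℕ) (x y : X) : ℝ≥0 :=
  (S.timeSet n x ∩ S.timeSet n y).sup fun i => nndist (S.map^[i] x) (S.map^[i] y)

/-- `A` is an `(n, ε, σ, Y)`-separated set. -/
def IsSeparated (n : ℕ) (ε : ℝ) (Y A : Set X) : Prop :=
  A ⊆ Y ∧ ∀ x ∈ A, ∀ y ∈ A, x ≠ y → ε < S.iterDist n x y

/-- `sep(n, ε, σ, Y)`: the largest cardinality of an `(n, ε, σ, Y)`-separated set. -/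
def sep (n : ℕ) (ε : ℝ) (Y : Set X) : ℕ∞ :=
  ⨆ (A : Set X) (_ : S.IsSeparated n ε Y A), A.encard

/-- `ssep(n, ε, σ, K)`: the supremum of `sep(n, ε, σ, K ∩ F)` over the closed sets
`F ⊆ Dom(σ^(n-1))` (used for `n ≥ 1`). -/
def ssep (n : ℕ) (ε : ℝ) (K : Set X) : ℕ∞ :=
  ⨆ (F : Set X) (_ : IsClosed F ∧ F ⊆ S.domIter (n - 1)), S.sep n ε (K ∩ F)

/-- `h_ε(σ, K, d) = limsup (1/n) log ssep(n, ε, σ, K)`, in the extended reals. -/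
def metricEntropyAt (ε : ℝ) (K : Set X) : EReal :=
  limsup (fun n : ℕ => ENNReal.log (S.ssep n ε K : ℝ≥0∞) / (n : EReal)) atTop

/-- `h_d(σ, K) = lim_{ε → 0} h_ε(σ, K, d)`. As `h_ε` increases when `ε` decreases, the limit is
the supremum over `ε > 0`. -/
def metricEntropyOn (K : Set X) : EReal :=
  ⨆ (ε : ℝ) (_ : 0 < ε), S.metricEntropyAt ε K

/-- The metric entropy `h_d(σ)`: the supremum of `h_d(σ, K)` over the compact `K ⊆ X`. -/
def metricEntropy : EReal :=
  ⨆ (K : Set X) (_ : IsCompact K), S.metricEntropyOn K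

end Metric

end DeaconuRenault

/-! ## Graphs and their edge shifts -/

/-- A directed graph `(V, E, r, s)` (loops and parallel edges are allowed). -/
structure DirectedGraph (V E : Type*) where
  s : E → V
  r : E → V

namespace DirectedGraph

variable {V E : Type*} (G : DirectedGraph V E)

/-- Every vertex emits an edge. -/
def NoSinks : Prop := ∀ v, ∃ e, G.s e = v

/-- Every vertex emits finitely many edges. -/
def RowFinite : Prop := ∀ v, {e | G.s e = v}.Finite

/-- Every vertex emits and receives finitely many edges. -/
structure LocallyFinite : Prop where
  rowFinite : G.RowFinite
  finite_range : ∀ v, {e | G.r e = v}.Finite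

/-- The space of infinite paths `x₀x₁x₂…` of `G`. -/
def InfPath : Type _ := {x : ℕ → E // ∀ n, G.s (x (n + 1)) = G.r (x n)}

/-- The cylinder-set topology: the subspace topology of the product of discrete spaces. -/
instance : TopologicalSpace G.InfPath :=
  TopologicalSpace.induced Subtype.val (@Pi.topologicalSpace ℕ (fun _ => E) (fun _ => ⊥))

/-- The shift `x₀x₁x₂… ↦ x₁x₂…`. -/
def shift (x : G.InfPath) : G.InfPath :=
  ⟨fun n => x.1 (n + 1), fun n => x.2 (n + 1)⟩

/-- The smallest family of sets of vertices that contains the singletons (in particular the ranges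
of the edges) and is closed under finite unions and nonempty finite intersections. -/
inductive IsGenVertex : Set V → Prop
  | singleton (v : V) : IsGenVertex {v}
  | union (A B : Set V) : IsGenVertex A → IsGenVertex B → IsGenVertex (A ∪ B)
  | inter (A B : Set V) : IsGenVertex A → IsGenVertex B → (A ∩ B).Nonempty → IsGenVertex (A ∩ B)

/-- The set `𝔭` of finite paths: generalized vertices (length zero) and nonempty sequences of
consecutive edges. -/
inductive FinPath : Type _
  | vertices (A : Set V) (hA : IsGenVertex A) : FinPath
  | edges (l : List E) (hne : l ≠ []) (hl : l.IsChain fun e f => G.s f = G.r e) : FinPath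

variable {G} in
/-- `p` is an initial segment of the infinite path `x`. -/
def FinPath.IsInitial : G.FinPath → G.InfPath → Prop
  | .vertices A _, x => G.s (x.1 0) ∈ A
  | .edges l _ _, x => l = List.ofFn fun i : Fin l.length => x.1 i

open scoped Classical in
/-- The metric `d_X` of an enumeration `p 0, p 1, …` of the finite paths: `d_X(x, y) = 2^{-(i+1)}`
for `x ≠ y`, where `i` is least such that `p i` is an initial segment of exactly one of `x`, `y`.
(Enumerations start at `0` here, whence `i + 1`.) -/
def pathDist (p : ℕ ≃ G.FinPath) (x y : G.InfPath) : ℝ :=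
  if x = y then 0
  else (1 / 2) ^ (sInf {i | ¬((p i).IsInitial x ↔ (p i).IsInitial y)} + 1)


/-! ### The shift is a local homeomorphism -/

theorem isOpen_setOf_coord (n : ℕ) (F : Set E) : IsOpen {x : G.InfPath | x.1 n ∈ F} := by
  let _ : TopologicalSpace E := ⊥
  have : DiscreteTopology E := ⟨rfl⟩
  have h : Continuous fun x : G.InfPath => x.1 n :=
    (continuous_apply n).comp continuous_induced_dom
  exact (isOpen_discrete F).preimage h

theorem continuousOn_of_coord {Y : Type*} [TopologicalSpace Y] {f : Y → G.InfPath} {t : Set Y}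
    (h : ∀ n e, ∀ y ∈ t, (f y).1 n = e → ∀ᶠ z in 𝓝[t] y, (f z).1 n = e) :
    ContinuousOn f t := by
  let _ : TopologicalSpace E := ⊥
  have : DiscreteTopology E := ⟨rfl⟩
  intro y hy
  have : Tendsto (fun z => (f z).1) (𝓝[t] y) (𝓝 (f y).1) := by
    rw [tendsto_pi_nhds]
    intro n
    rw [nhds_discrete, tendsto_pure]
    exact h n _ y hy rfl
  rw [ContinuousWithinAt, nhds_induced, tendsto_comap_iff]
  exact this

theorem continuous_shift : Continuous G.shift := by
  rw [← continuousOn_univ]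
  refine G.continuousOn_of_coord fun n e y _ hy => ?_
  rw [nhdsWithin_univ]
  exact (G.isOpen_setOf_coord (n + 1) {e}).mem_nhds hy

/-- The path obtained by putting the edge `e` in front of `x`. -/
def cons (e : E) (x : G.InfPath) (h : G.s (x.1 0) = G.r e) : G.InfPath :=
  ⟨fun n => Nat.casesOn n e x.1, fun n => by
    cases n with
    | zero => exact h
    | succ n => exact x.2 n⟩

open scoped Classical in
theorem isLocalHomeomorphOn_shift : IsLocalHomeomorphOn G.shift univ := by
  intro x _
  let e : E := x.1 0
  let inv : G.InfPath → G.InfPath := fun y =>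
    if h : G.s (y.1 0) = G.r e then G.cons e y h else y
  have hinv : ∀ y : G.InfPath, ∀ h : G.s (y.1 0) = G.r e, inv y = G.cons e y h :=
    fun y h => dif_pos h
  refine ⟨{ toFun := G.shift
            invFun := inv
            source := {y | y.1 0 ∈ ({e} : Set E)}
            target := {y | y.1 0 ∈ {f | G.s f = G.r e}}
            map_source' := ?_
            map_target' := ?_
            left_inv' := ?_
            right_inv' := ?_
            open_source := G.isOpen_setOf_coord 0 _
            open_target := G.isOpen_setOf_coord 0 _
            continuousOn_toFun := G.continuous_shift.continuousOn
            continuousOn_invFun := ?_ }, rfl, rfl⟩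
  · intro y hy
    have hy' : y.1 0 = e := hy
    change G.s (y.1 1) = G.r e
    rw [← hy']
    exact y.2 0
  · intro y hy
    change (inv y).1 0 = e
    rw [hinv y hy]
    rfl
  · intro y hy
    have hy' : y.1 0 = e := hy
    have h : G.s ((G.shift y).1 0) = G.r e := by
      rw [← hy']
      exact y.2 0
    rw [hinv _ h]
    apply Subtype.ext
    funext n
    cases n with
    | zero => exact hy'.symm
    | succ n => rfl
  · intro y hy
    rw [hinv y hy]
    rfl
  · refine G.continuousOn_of_coord fun n f y hy hf => ?_
    rw [hinv y hy] at hf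
    cases n with
    | zero =>
      filter_upwards [self_mem_nhdsWithin] with z hz
      rw [hinv z hz]
      exact hf
    | succ n =>
      filter_upwards [self_mem_nhdsWithin,
        mem_nhdsWithin_of_mem_nhds ((G.isOpen_setOf_coord n {f}).mem_nhds hf)] with z hz hz'
      rw [hinv z hz]
      exact hz'

theorem t2Space_infPath : T2Space G.InfPath := by
  let _ : TopologicalSpace E := ⊥
  have : DiscreteTopology E := ⟨rfl⟩
  exact (Topology.IsEmbedding.mk ⟨rfl⟩ Subtype.val_injective :
    Topology.IsEmbedding (Subtype.val : G.InfPath → ℕ → E)).t2Space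

theorem isClosed_range_val : @IsClosed (ℕ → E) (@Pi.topologicalSpace ℕ (fun _ => E) (fun _ => ⊥))
    (range (Subtype.val : G.InfPath → ℕ → E)) := by
  let _ : TopologicalSpace E := ⊥
  have : DiscreteTopology E := ⟨rfl⟩
  have : range (Subtype.val : G.InfPath → ℕ → E)
      = ⋂ n, (fun x : ℕ → E => (x (n + 1), x n)) ⁻¹' {q | G.s q.1 = G.r q.2} := by
    ext x
    simp only [mem_range, mem_iInter, mem_preimage, mem_ofPred_eq]
    exact ⟨fun ⟨y, hy⟩ n => hy ▸ y.2 n, fun h => ⟨⟨x, h⟩, rfl⟩⟩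
  rw [this]
  exact isClosed_iInter fun n => (isClosed_discrete _).preimage
    ((continuous_apply (n + 1)).prodMk (continuous_apply n))

theorem isCompact_cylinder (h : G.RowFinite) (e : E) : IsCompact {x : G.InfPath | x.1 0 = e} := by
  let _ : TopologicalSpace E := ⊥
  have : DiscreteTopology E := ⟨rfl⟩
  let F : ℕ → Set E := fun n => Nat.rec {e} (fun _ A => ⋃ f ∈ A, {g | G.s g = G.r f}) n
  have hF : ∀ n, (F n).Finite := fun n => by
    induction n with
    | zero => exact finite_singleton e
    | succ n ih => exact ih.biUnion fun f _ => h _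
  have hemb : Topology.IsClosedEmbedding (Subtype.val : G.InfPath → ℕ → E) :=
    ⟨⟨⟨rfl⟩, Subtype.val_injective⟩, G.isClosed_range_val⟩
  have hK : IsCompact (Subtype.val ⁻¹' (Set.pi univ F) : Set G.InfPath) :=
    hemb.isCompact_preimage (isCompact_univ_pi fun n => (hF n).isCompact)
  refine hK.of_isClosed_subset ?_ ?_
  · have := G.isOpen_setOf_coord 0 {e}ᶜ
    rw [← isOpen_compl_iff]
    exact this
  · intro x hx n _
    induction n with
    | zero => exact hx
    | succ n ih => exact mem_biUnion (ih trivial) (x.2 n)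

theorem locallyCompactSpace_infPath (h : G.RowFinite) : LocallyCompactSpace G.InfPath := by
  have := G.t2Space_infPath
  have : WeaklyLocallyCompactSpace G.InfPath :=
    ⟨fun x => ⟨_, G.isCompact_cylinder h (x.1 0),
      (G.isOpen_setOf_coord 0 {x.1 0}).mem_nhds rfl⟩⟩
  infer_instance

/-- The Deaconu–Renault system of a row-finite graph: the shift on the space of infinite paths,
defined everywhere. -/
def shiftSystem (h : G.RowFinite) : DeaconuRenault G.InfPath where
  t2 := G.t2Space_infPath
  locallyCompact := G.locallyCompactSpace_infPath h
  dom := univ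
  isOpen_dom := isOpen_univ
  map := G.shift
  isLocalHomeomorphOn := G.isLocalHomeomorphOn_shift

/-! ### `d_X` is a metric inducing the cylinder-set topology -/

variable {G}

/-- The initial segment of length `n + 1` of an infinite path. -/
def initialPath (x : G.InfPath) (n : ℕ) : G.FinPath :=
  .edges (List.ofFn fun i : Fin (n + 1) => x.1 i) (by simp) (by
    rw [List.isChain_iff_getElem]
    intro i hi
    simpa [-List.ofFn_succ] using x.2 i)

theorem isInitial_initialPath {x y : G.InfPath} {n : ℕ} :
    (initialPath x n).IsInitial y ↔ ∀ i ≤ n, x.1 i = y.1 i := by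
  constructor
  · intro h i hi
    have h' : (List.ofFn fun i : Fin (n + 1) => x.1 i)
      = List.ofFn fun i : Fin (List.ofFn fun i : Fin (n + 1) => x.1 i).length => y.1 i := h
    have := congrArg (fun l => l[i]?) h'
    simpa [-List.ofFn_succ, List.getElem?_ofFn, Nat.lt_succ_iff, hi] using this
  · intro h
    change (List.ofFn fun i : Fin (n + 1) => x.1 i)
      = List.ofFn fun i : Fin (List.ofFn fun i : Fin (n + 1) => x.1 i).length => y.1 i
    apply List.ext_getElem
    · simp
    · intro i h1 h2
      have : i < n + 1 := by simpa using h1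
      simpa [-List.ofFn_succ] using h i (by omega)

theorem isOpen_setOf_isInitial_iff (q : G.FinPath) (x : G.InfPath) :
    IsOpen {y : G.InfPath | q.IsInitial x ↔ q.IsInitial y} := by
  cases q with
  | vertices A hA =>
    exact G.isOpen_setOf_coord 0 {e | G.s (x.1 0) ∈ A ↔ G.s e ∈ A}
  | edges l hne hl =>
    rw [isOpen_iff_mem_nhds]
    intro y hy
    have : ∀ᶠ z : G.InfPath in 𝓝 y, ∀ i : Fin l.length, z.1 i = y.1 i :=
      eventually_all.2 fun i => (G.isOpen_setOf_coord i {y.1 i}).mem_nhds rfl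
    filter_upwards [this] with z hz
    refine Iff.trans hy ?_
    simp only [FinPath.IsInitial, hz]

theorem exists_not_isInitial_iff (p : ℕ ≃ G.FinPath) {x y : G.InfPath} (h : x ≠ y) :
    ∃ i, ¬((p i).IsInitial x ↔ (p i).IsInitial y) := by
  obtain ⟨n, hn⟩ : ∃ n, x.1 n ≠ y.1 n := by
    by_contra! hc
    exact h (Subtype.ext (funext hc))
  refine ⟨p.symm (initialPath x n), ?_⟩
  rw [Equiv.apply_symm_apply]
  simp only [isInitial_initialPath]
  exact fun hc => hn (hc.1 (by simp) n le_rfl)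

theorem pathDist_lt_iff (p : ℕ ≃ G.FinPath) (x y : G.InfPath) (n : ℕ) :
    G.pathDist p x y < (1 / 2) ^ n ↔ ∀ i < n, ((p i).IsInitial x ↔ (p i).IsInitial y) := by
  by_cases h : x = y
  · subst h
    simp [pathDist]
  · rw [pathDist, if_neg h, pow_lt_pow_iff_right_of_lt_one₀ (by norm_num) (by norm_num)]
    constructor
    · intro hn i hi
      by_contra hc
      have := Nat.sInf_le (s := {i | ¬((p i).IsInitial x ↔ (p i).IsInitial y)}) hc
      omega
    · intro hc
      by_contra hn
      exact Nat.sInf_mem (exists_not_isInitial_iff p h) (hc _ (Nat.lt_of_succ_le (not_lt.1 hn)))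

variable (G) in
/-- `d_X` as a metric space structure (with its own metric topology). -/
@[reducible] def pathMetricAux (p : ℕ ≃ G.FinPath) : MetricSpace G.InfPath where
  dist := G.pathDist p
  dist_self x := by simp [pathDist]
  dist_comm x y := by
    by_cases h : x = y
    · rw [h]
    · simp only [pathDist, if_neg h, if_neg (Ne.symm h), iff_comm (a := (p _).IsInitial x)]
  dist_triangle x y z := by
    have h0 : ∀ u v, 0 ≤ G.pathDist p u v := fun u v => by
      rw [pathDist]; split_ifs <;> positivity
    by_cases h : x = z
    · subst h
      rw [show G.pathDist p x x = 0 by simp [pathDist]]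
      exact add_nonneg (h0 _ _) (h0 _ _)
    · have hm := Nat.sInf_mem (exists_not_isInitial_iff p h)
      have hd : G.pathDist p x z =
        (1 / 2) ^ (sInf {i | ¬((p i).IsInitial x ↔ (p i).IsInitial z)} + 1) := if_neg h
      rw [hd]
      set m := sInf {i | ¬((p i).IsInitial x ↔ (p i).IsInitial z)}
      by_cases hxy : (p m).IsInitial x ↔ (p m).IsInitial y
      · have : ¬ G.pathDist p y z < (1 / 2) ^ (m + 1) := fun hlt =>
          hm (hxy.trans ((pathDist_lt_iff p y z _).1 hlt m (Nat.lt_succ_self m)))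
        linarith [h0 x y]
      · have : ¬ G.pathDist p x y < (1 / 2) ^ (m + 1) := fun hlt =>
          hxy ((pathDist_lt_iff p x y _).1 hlt m (Nat.lt_succ_self m))
        linarith [h0 y z]
  eq_of_dist_eq_zero := fun {x y} hxy => by
    by_contra h
    have hxy' : G.pathDist p x y = 0 := hxy
    rw [pathDist, if_neg h] at hxy'
    exact absurd hxy' (by positivity)

theorem pathMetricAux_topology (p : ℕ ≃ G.FinPath) :
    (inferInstance : TopologicalSpace G.InfPath)
      = (G.pathMetricAux p).toUniformSpace.toTopologicalSpace := by
  refine TopologicalSpace.ext_nhds fun x => le_antisymm ?_ ?_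
  · refine (@Metric.nhds_basis_ball _ (G.pathMetricAux p).toPseudoMetricSpace x).ge_iff.2
      fun ε hε => ?_
    obtain ⟨n, hn⟩ := exists_pow_lt_of_lt_one hε (by norm_num : (1 / 2 : ℝ) < 1)
    have : ∀ᶠ y : G.InfPath in 𝓝 x, ∀ i : Fin n, ((p i).IsInitial x ↔ (p i).IsInitial y) :=
      eventually_all.2 fun i => (isOpen_setOf_isInitial_iff (p i) x).mem_nhds Iff.rfl
    filter_upwards [this] with y hy
    exact ((pathDist_lt_iff p y x n).2 fun i hi => (hy ⟨i, hi⟩).symm).trans hn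
  · let _ : TopologicalSpace E := ⊥
    have : DiscreteTopology E := ⟨rfl⟩
    suffices key : Tendsto (Subtype.val : G.InfPath → ℕ → E)
        (@nhds _ (G.pathMetricAux p).toUniformSpace.toTopologicalSpace x) (𝓝 x.1) by
      exact (tendsto_iff_comap.1 key).trans_eq (nhds_induced _ _).symm
    rw [tendsto_pi_nhds]
    intro n
    rw [nhds_discrete, tendsto_pure]
    refine (@Metric.nhds_basis_ball _ (G.pathMetricAux p).toPseudoMetricSpace x).eventually_iff.2
      ⟨(1 / 2) ^ (p.symm (initialPath x n) + 1), by positivity, fun y hy => ?_⟩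
    have h := (pathDist_lt_iff p y x _).1 hy _ (Nat.lt_succ_self _)
    rw [Equiv.apply_symm_apply, isInitial_initialPath, isInitial_initialPath] at h
    exact (h.2 (by simp) n le_rfl).symm

variable (G) in
/-- `d_X` as a metric on the space of infinite paths: `dist x y = pathDist p x y`, and the
underlying topology is the cylinder-set topology. -/
@[reducible] def pathMetric (p : ℕ ≃ G.FinPath) : MetricSpace G.InfPath :=
  MetricSpace.replaceTopology (G.pathMetricAux p) (pathMetricAux_topology p)

variable (G)

/-- The topological entropy of a row-finite graph. -/
def topologicalEntropy (h : G.RowFinite) : EReal :=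
  (G.shiftSystem h).topologicalEntropy

/-- The metric entropy of a row-finite graph, with respect to the metric `d_X` of an enumeration
`p` of the finite paths. -/
def metricEntropy (h : G.RowFinite) (p : ℕ ≃ G.FinPath) : EReal :=
  @DeaconuRenault.metricEntropy _ (G.pathMetric p) (G.shiftSystem h)

end DirectedGraph

end

/-! Cover entropy is at most metric entropy for every system defined on all of a nonempty metric
space (`topologicalEntropy_le_metricEntropy`). At half a Lebesgue number of the cover, a maximal
separated subset of `K_n` yields a subcover of no larger cardinality.

The converse needs the graph, since separated orbits may leave every compact set while covers only
count orbits that stay in one. At scale `ε` the metric tests finitely many finite paths, and by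
row-finiteness these tests only involve finitely many edges `F` in a bounded window. Separated
points are thus told apart by the word obtained by blanking all edges outside `F`
(`exists_ssep_le_card_words`).

Let `c` be the topological entropy. Loops of length `l` at an edge `e` can be concatenated freely
inside a compact set, so finitely many of them number at most `exp (c * l)`
(`log_card_loops_div_le`, `card_loopWords_le`). A blanked word is cut at its first and last visit to
`e`: the middle is a loop, and the two ends avoid `e` (`words_subset`). Induction on `F` bounds the
number of words of length `n` by a polynomial times `exp (c * n)` (`card_words_le`), and the
polynomial does not affect the growth rate. -/

/-! ### Growth rates in the extended reals. -/

theorem EReal.limsup_div_le_of_eventually_le {f : ℕ → EReal} {a : ℕ → ℝ} {c : ℝ}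
    (hf : ∀ᶠ n in atTop, f n ≤ (a n : EReal))
    (ha : Tendsto (fun n : ℕ => a n / n) atTop (𝓝 c)) :
    limsup (fun n : ℕ => f n / (n : EReal)) atTop ≤ c := by
  have h : Tendsto (fun n : ℕ => ((a n / n : ℝ) : EReal)) atTop (𝓝 (c : EReal)) :=
    (continuous_coe_real_ereal.tendsto c).comp ha
  rw [← h.limsup_eq]
  refine limsup_le_limsup ?_
  filter_upwards [hf] with n hn
  have : ((a n / n : ℝ) : EReal) = (a n : EReal) / (n : EReal) := by
    rw [EReal.coe_div]; rfl
  rw [this]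
  exact EReal.div_le_div_right_of_nonneg (by positivity) hn

/-- Absorbs an index shift: `α_n` looks at the `n + 1` times `0, …, n`, whereas `d_n` looks at `n`.
For real `c` above the right side, `f (n + 1) < c * (n + 1)` eventually, and `c * (n + 1) / n` tends
to `c`. -/
theorem EReal.limsup_succ_div_le (f : ℕ → EReal) :
    limsup (fun n : ℕ => f (n + 1) / (n : EReal)) atTop
      ≤ limsup (fun n : ℕ => f n / (n : EReal)) atTop := by
  refine EReal.le_of_forall_lt_iff_le.1 fun c hc => ?_
  have hev := (tendsto_add_atTop_nat 1).eventually (eventually_lt_of_limsup_lt hc)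
  refine EReal.limsup_div_le_of_eventually_le (a := fun n => c * (n + 1)) ?_ ?_
  · filter_upwards [hev] with n hn
    rw [EReal.div_lt_iff (by positivity) (EReal.natCast_ne_top _)] at hn
    refine hn.le.trans_eq ?_
    push_cast
    norm_cast
  · have h : Tendsto (fun n : ℕ => c * (1 + 1 / (n : ℝ))) atTop (𝓝 (c * (1 + 0))) :=
      (tendsto_const_nhds.add tendsto_one_div_atTop_nhds_zero_nat).const_mul c
    rw [add_zero, mul_one] at h
    refine h.congr' ?_
    filter_upwards [eventually_gt_atTop 0] with n hn
    have : (n : ℝ) ≠ 0 := by positivity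
    field_simp

/-! ### Covers and itineraries for systems defined everywhere. -/

namespace DeaconuRenault

theorem coverNumber_le_encard {X : Type*} {α β : Set (Set X)} {Y : Set X} (hβ : β ⊆ α) (hY : Y ⊆ ⋃₀ β) :
    coverNumber α Y ≤ max 1 β.encard :=
  max_le_max le_rfl (iInf₂_le β ⟨hβ, hY⟩)

/-- Choosing for each point of `T` a member of the subcover that contains it is injective. -/
theorem encard_le_coverNumber {X : Type*} {α : Set (Set X)} {Y T : Set X} (hT : T ⊆ Y)
    (hα : ∀ A ∈ α, (A ∩ T).Subsingleton) : T.encard ≤ coverNumber α Y := by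
  refine le_max_of_le_right (le_iInf₂ fun β hβ => ?_)
  have : ∀ x ∈ T, ∃ B ∈ β, x ∈ B := fun x hx => hβ.2 (hT hx)
  choose! B hB hxB using this
  exact encard_le_encard_of_injOn hB fun x hx y hy hxy =>
    hα _ (hβ.1 (hB x hx)) ⟨hxB x hx, hx⟩ ⟨hxy ▸ hxB y hy, hy⟩

theorem coverH_nonneg {X : Type*} (α : Set (Set X)) (Y : Set X) : 0 ≤ coverH α Y := by
  rw [coverH, ENNReal.zero_le_log_iff]
  exact_mod_cast (le_max_left _ _ : (1 : ℕ∞) ≤ coverNumber α Y)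

section Topological

variable {X : Type*} [TopologicalSpace X] (S : DeaconuRenault X)

theorem domIter_eq_univ (h : S.dom = univ) (n : ℕ) : S.domIter n = univ := by
  induction n with
  | zero => rfl
  | succ n ih => simp [domIter, h, ih]

theorem preim_eq_preimage (h : S.dom = univ) (i : ℕ) (A : Set X) :
    S.preim i A = S.map^[i] ⁻¹' A := by
  simp [preim, S.domIter_eq_univ h]

theorem mem_setIter_iff (h : S.dom = univ) {K : Set X} {n : ℕ} {x : X} :
    x ∈ S.setIter K n ↔ ∀ i ≤ n, S.map^[i] x ∈ K := by
  induction n with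
  | zero => simp [setIter]
  | succ n ih =>
    rw [setIter, mem_inter_iff, ih, S.preim_eq_preimage h, mem_preimage]
    constructor
    · rintro ⟨h1, h2⟩ i hi
      rcases hi.lt_or_eq with hi | rfl
      · exact h1 i (Nat.le_of_lt_succ hi)
      · exact h2
    · exact fun h' => ⟨fun i hi => h' i (hi.trans n.le_succ), h' _ le_rfl⟩

/-- Replaces the recursive join by itineraries, so that membership can be checked one time at a
time. -/
theorem mem_coverIter_iff (h : S.dom = univ) {α : Set (Set X)} {n : ℕ} {C : Set X} :
    C ∈ S.coverIter α n ↔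
      ∃ A : ℕ → Set X, (∀ i ≤ n, A i ∈ α) ∧ C = {x | ∀ i ≤ n, S.map^[i] x ∈ A i} := by
  induction n generalizing C with
  | zero =>
    constructor
    · exact fun hC => ⟨fun _ => C, fun _ _ => hC, by simp⟩
    · rintro ⟨A, hA, rfl⟩
      simpa [coverIter] using hA 0 le_rfl
  | succ n ih =>
    constructor
    · rintro ⟨C', hC', _, ⟨B, hB, rfl⟩, rfl⟩
      obtain ⟨A, hA, rfl⟩ := ih.1 hC'
      refine ⟨fun i => if i ≤ n then A i else B, fun i _ => ?_, ?_⟩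
      · dsimp only
        split_ifs with hi
        exacts [hA i hi, hB]
      · ext x
        simp only [mem_inter_iff, mem_ofPred_eq, S.preim_eq_preimage h, mem_preimage]
        constructor
        · rintro ⟨h1, h2⟩ i hi
          split_ifs with hi'
          · exact h1 i hi'
          · rwa [show i = n + 1 by omega]
        · intro h'
          refine ⟨fun i hi => ?_, ?_⟩
          · simpa [hi] using h' i (by omega)
          · simpa using h' (n + 1) le_rfl
    · rintro ⟨A, hA, rfl⟩
      refine ⟨_, ih.2 ⟨A, fun i hi => hA i (by omega), rfl⟩, _, ⟨A (n + 1), hA _ le_rfl, rfl⟩, ?_⟩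
      ext x
      simp only [mem_inter_iff, mem_ofPred_eq, S.preim_eq_preimage h, mem_preimage]
      constructor
      · exact fun h' => ⟨fun i hi => h' i (by omega), h' _ le_rfl⟩
      · rintro ⟨h1, h2⟩ i hi
        rcases hi.lt_or_eq with hi | rfl
        · exact h1 i (Nat.le_of_lt_succ hi)
        · exact h2

theorem entropyCover_nonneg (α : Set (Set X)) (K : Set X) : 0 ≤ S.entropyCover α K :=
  le_limsup_of_frequently_le' (Frequently.of_forall fun n =>
    EReal.div_nonneg (coverH_nonneg _ _) (by positivity))

theorem entropyCover_le_topologicalEntropy {α : Set (Set X)} {K : Set X} (hK : IsCompact K)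
    (hα : IsOpenCover α K) : S.entropyCover α K ≤ S.topologicalEntropy :=
  (le_iSup₂ (f := fun (α : Set (Set X)) (_ : IsOpenCover α K) => S.entropyCover α K) α hα).trans
    (le_iSup₂ (f := fun (K : Set X) (_ : IsCompact K) => S.topologicalEntropyOn K) K hK)

theorem topologicalEntropy_nonneg : 0 ≤ S.topologicalEntropy :=
  (S.entropyCover_nonneg ∅ ∅).trans (S.entropyCover_le_topologicalEntropy isCompact_empty
    ⟨by simp, by simp⟩)

end Topological

/-! ### Separated sets, and the bound of cover entropy by metric entropy. -/

section Metric

variable {X : Type*} [MetricSpace X] (S : DeaconuRenault X)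

theorem lt_iterDist_iff (h : S.dom = univ) {n : ℕ} {x y : X} {ε : ℝ} (hε : 0 ≤ ε) :
    ε < S.iterDist n x y ↔ ∃ i < n, ε < dist (S.map^[i] x) (S.map^[i] y) := by
  lift ε to ℝ≥0 using hε
  rw [NNReal.coe_lt_coe, iterDist, Finset.lt_sup_iff]
  simp only [timeSet, S.domIter_eq_univ h, mem_univ, Finset.filter_true, Finset.inter_self,
    Finset.mem_range, dist_nndist, NNReal.coe_lt_coe]

theorem encard_le_ssep (h : S.dom = univ) {n : ℕ} {ε : ℝ} {K A : Set X}
    (hA : S.IsSeparated n ε K A) : A.encard ≤ S.ssep n ε K := by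
  refine le_trans ?_ (le_iSup₂ (f := fun (F : Set X)
    (_ : IsClosed F ∧ F ⊆ S.domIter (n - 1)) => S.sep n ε (K ∩ F)) univ
    ⟨isClosed_univ, (S.domIter_eq_univ h _).ge⟩)
  rw [inter_univ]
  exact le_iSup₂ (f := fun (A : Set X) (_ : S.IsSeparated n ε K A) => A.encard) A hA

theorem ssep_le {n : ℕ} {ε : ℝ} {K : Set X} {m : ℕ∞}
    (hm : ∀ A, S.IsSeparated n ε K A → A.encard ≤ m) : S.ssep n ε K ≤ m :=
  iSup₂_le fun _ _ => iSup₂_le fun A hA => hm A ⟨hA.1.trans inter_subset_left, hA.2⟩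

theorem one_le_ssep (h : S.dom = univ) (n : ℕ) (ε : ℝ) {K : Set X} (hK : K.Nonempty) :
    1 ≤ S.ssep n ε K := by
  obtain ⟨x, hx⟩ := hK
  rw [← encard_singleton x]
  refine S.encard_le_ssep h ⟨singleton_subset_iff.2 hx, ?_⟩
  rintro _ rfl _ rfl hne
  exact absurd rfl hne

/-- A maximal separated set, given by Zorn's lemma, spans: a point far from all of it could be
added. -/
theorem exists_isSeparated_forall_exists_not_lt (n : ℕ) (ε : ℝ) (Y : Set X) :
    ∃ A, S.IsSeparated n ε Y A ∧ ∀ x ∈ Y, ∃ y ∈ A, x = y ∨ ¬ ε < S.iterDist n x y := by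
  obtain ⟨A, hA⟩ := zorn_subset {A | S.IsSeparated n ε Y A} fun c hc hchain => by
    refine ⟨⋃₀ c, ⟨sUnion_subset fun A hA => (hc hA).1, ?_⟩, fun s hs => subset_sUnion_of_mem hs⟩
    rintro x ⟨A, hA, hx⟩ y ⟨B, hB, hy⟩ hxy
    rcases hchain.total hA hB with hAB | hBA
    · exact (hc hB).2 x (hAB hx) y hy hxy
    · exact (hc hA).2 x hx y (hBA hy) hxy
  refine ⟨A, hA.prop, fun x hx => ?_⟩
  by_contra! hcon
  have hsep : S.IsSeparated n ε Y (insert x A) := by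
    refine ⟨insert_subset hx hA.prop.1, ?_⟩
    have hcomm : ∀ u v, S.iterDist n u v = S.iterDist n v u := fun u v => by
      simp only [iterDist, nndist_comm, Finset.inter_comm]
    rintro u (rfl | hu) v (rfl | hv) huv
    · exact absurd rfl huv
    · exact (hcon v hv).2
    · rw [hcomm]
      exact (hcon u hu).2
    · exact hA.prop.2 u hu v hv huv
  exact (hcon x (hA.le_of_ge hsep (subset_insert x A) (mem_insert x A))).1 rfl

theorem topologicalEntropy_le_metricEntropy [Nonempty X] (h : S.dom = univ) :
    S.topologicalEntropy ≤ S.metricEntropy := by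
  refine iSup₂_le fun K hK => iSup₂_le fun α hα => ?_
  obtain ⟨δ, hδ, hball⟩ := lebesgue_number_lemma_of_metric_sUnion hK hα.1 hα.2
  choose! U hUα hU using hball
  -- Adjoining a point keeps `ssep` at least `1`, matching the convention that `coverNumber` is `1`
  -- on an empty `K_n`.
  obtain ⟨x₀⟩ := ‹Nonempty X›
  have hK' : IsCompact (insert x₀ K) := hK.insert x₀
  have hne : (insert x₀ K).Nonempty := insert_nonempty _ _
  have key : ∀ n, coverNumber (S.coverIter α n) (S.setIter K n)
      ≤ S.ssep (n + 1) (δ / 2) (insert x₀ K) := fun n => by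
    -- The centres are taken in `K_n`, so their orbits stay in `K` up to time `n` and the Lebesgue
    -- property applies at each of those times.
    obtain ⟨A, hA, hspan⟩ := S.exists_isSeparated_forall_exists_not_lt (n + 1) (δ / 2)
      (S.setIter K n)
    have horb : ∀ y ∈ A, ∀ i ≤ n, S.map^[i] y ∈ K := fun y hy =>
      (S.mem_setIter_iff h).1 (hA.1 hy)
    let C : X → Set X := fun y => {x | ∀ i ≤ n, S.map^[i] x ∈ U (S.map^[i] y)}
    refine (coverNumber_le_encard (β := C '' A) ?_ ?_).trans (max_le (S.one_le_ssep h _ _ hne)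
      ((encard_image_le _ _).trans (S.encard_le_ssep h ⟨fun y hy => ?_, hA.2⟩)))
    · rintro _ ⟨y, hy, rfl⟩
      exact (S.mem_coverIter_iff h).2
        ⟨fun i => U (S.map^[i] y), fun i hi => hUα _ (horb y hy i hi), rfl⟩
    · intro x hx
      obtain ⟨y, hy, hxy⟩ := hspan x hx
      refine ⟨C y, mem_image_of_mem C hy, fun i hi => hU _ (horb y hy i hi) ?_⟩
      rw [Metric.mem_ball]
      rcases hxy with rfl | hxy
      · simpa using hδ
      · rw [S.lt_iterDist_iff h (by positivity)] at hxy
        push Not at hxy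
        linarith [hxy i (by omega)]
    · exact mem_insert_of_mem _ (horb y hy 0 n.zero_le)
  calc S.entropyCover α K
      ≤ limsup (fun n : ℕ => ENNReal.log
          (S.ssep (n + 1) (δ / 2) (insert x₀ K) : ℝ≥0∞) / (n : EReal)) atTop := by
        refine limsup_le_limsup (Eventually.of_forall fun n => ?_)
        refine EReal.div_le_div_right_of_nonneg (by positivity) ?_
        rw [coverH, ENNReal.log_le_log_iff]
        exact_mod_cast key n
    _ ≤ S.metricEntropyAt (δ / 2) (insert x₀ K) :=
        EReal.limsup_succ_div_le
          fun n => ENNReal.log (S.ssep n (δ / 2) (insert x₀ K) : ℝ≥0∞)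
    _ ≤ S.metricEntropyOn (insert x₀ K) :=
        le_iSup₂ (f := fun (ε : ℝ) (_ : 0 < ε) => S.metricEntropyAt ε (insert x₀ K)) (δ / 2)
          (by positivity)
    _ ≤ S.metricEntropy :=
        le_iSup₂ (f := fun (K : Set X) (_ : IsCompact K) => S.metricEntropyOn K) _ hK'

end Metric

end DeaconuRenault

/-! ### Infinite paths and generalized vertices of a graph. -/

namespace DirectedGraph

variable {V E : Type*} (G : DirectedGraph V E)

variable {G} in
theorem NoSinks.nonempty_infPath [Nonempty V] (h : G.NoSinks) : Nonempty G.InfPath := by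
  choose f hf using h
  obtain ⟨v⟩ := ‹Nonempty V›
  exact ⟨⟨fun n => f ((fun w => G.r (f w))^[n] v), fun n => by
    rw [hf, Function.iterate_succ_apply']⟩⟩

theorem nonempty_of_finPath (q : G.FinPath) : Nonempty V := by
  cases q with
  | vertices A hA =>
    have : A.Nonempty := by
      induction hA with
      | singleton v => exact singleton_nonempty v
      | union A B _ _ hA _ => exact hA.inl
      | inter A B _ _ h _ _ => exact h
    exact ⟨this.some⟩
  | edges l hne hl => exact ⟨G.s (l.head hne)⟩

theorem IsGenVertex.finite {A : Set V} (hA : IsGenVertex A) : A.Finite := by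
  induction hA with
  | singleton v => exact finite_singleton v
  | union A B _ _ hA hB => exact hA.union hB
  | inter A B _ _ _ hA _ => exact hA.inter_of_left B

variable {G}

theorem shift_iterate_apply (x : G.InfPath) (i t : ℕ) : (G.shift^[i] x).1 t = x.1 (t + i) := by
  induction i generalizing x with
  | zero => rfl
  | succ i ih =>
    rw [Function.iterate_succ_apply, ih]
    rfl

/-! ### Loops and the topological entropy -/

/-- The infinite concatenation of the loops `y (z 0), y (z 1), …` of length `l` based at the source
of the edge `e`. -/
def loopConcat {ι : Type*} {y : ι → G.InfPath} {e : E} {l : ℕ} (hl : 0 < l)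
    (h0 : ∀ a, (y a).1 0 = e) (h1 : ∀ a, (y a).1 l = e) (z : ℕ → ι) : G.InfPath :=
  ⟨fun t => (y (z (t / l))).1 (t % l), fun t => by
    change G.s ((y (z ((t + 1) / l))).1 ((t + 1) % l)) = G.r ((y (z (t / l))).1 (t % l))
    have hlt := Nat.mod_lt t hl
    have ht := Nat.div_add_mod t l
    rcases Nat.lt_or_ge (t % l + 1) l with h | h
    · have hdm := (Nat.div_mod_unique hl (a := t + 1) (d := t / l)).2
        ⟨by omega, h⟩
      rw [hdm.1, hdm.2]
      exact (y _).2 _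
    · have hm : (t + 1) % l = 0 := by
        rw [← Nat.mod_add_mod, show t % l + 1 = l by omega, Nat.mod_self]
      rw [hm, h0, ← h1 (z (t / l)), ← (y _).2, show t % l + 1 = l by omega]⟩

theorem isCompact_setOf_coord_zero_mem (h : G.RowFinite) {H : Set E} (hH : H.Finite) :
    IsCompact {x : G.InfPath | x.1 0 ∈ H} := by
  have : {x : G.InfPath | x.1 0 ∈ H} = ⋃ f ∈ H, {x : G.InfPath | x.1 0 = f} := by
    ext x; simp
  rw [this]
  exact hH.isCompact_biUnion fun f _ => G.isCompact_cylinder h f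

/-- The cover number of the partition into edges, iterated `n` times, is at least the number of
paths of length `n + 1` with edges in `H`. -/
theorem card_le_coverNumber (h : G.RowFinite) {H : Set E} {κ : Type*} [Fintype κ] {n : ℕ}
    (x : κ → G.InfPath) (hx : ∀ a, ∀ i ≤ n, (x a).1 i ∈ H)
    (hinj : ∀ a b, (∀ i ≤ n, (x a).1 i = (x b).1 i) → a = b) :
    (Fintype.card κ : ℕ∞) ≤ DeaconuRenault.coverNumber
      ((G.shiftSystem h).coverIter ((fun f => {x : G.InfPath | x.1 0 ∈ ({f} : Set E)}) '' H) n)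
      ((G.shiftSystem h).setIter {x | x.1 0 ∈ H} n) := by
  have hxinj : Function.Injective x := fun a b hab => hinj a b fun i _ => by rw [hab]
  have hcard : (range x).encard = Fintype.card κ := by
    rw [← image_univ, hxinj.encard_image, encard_univ, ENat.card_eq_coe_fintype_card]
  rw [← hcard]
  refine DeaconuRenault.encard_le_coverNumber ?_ ?_
  · rintro _ ⟨a, rfl⟩
    rw [(G.shiftSystem h).mem_setIter_iff rfl]
    intro i hi
    change (G.shift^[i] (x a)).1 0 ∈ H
    rw [shift_iterate_apply, zero_add]
    exact hx a i hi
  · intro C hC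
    obtain ⟨A, hA, rfl⟩ := ((G.shiftSystem h).mem_coverIter_iff rfl).1 hC
    rintro _ ⟨ha, a, rfl⟩ _ ⟨hb, b, rfl⟩
    refine congrArg x (hinj a b fun i hi => ?_)
    obtain ⟨f, -, hf⟩ := hA i hi
    have ha' : G.shift^[i] (x a) ∈ A i := ha i hi
    have hb' : G.shift^[i] (x b) ∈ A i := hb i hi
    rw [← hf] at ha' hb'
    change (G.shift^[i] (x a)).1 0 = f at ha'
    change (G.shift^[i] (x b)).1 0 = f at hb'
    rw [shift_iterate_apply, zero_add] at ha' hb'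
    rw [ha', hb']

/-- With `m` loops, the `k`-fold concatenations are `m ^ k` distinct paths of length `k * l`. All
their edges lie in a finite set `H`, so their orbits stay in the compact set of paths starting in
`H`, and the partition by first edge separates them. -/
theorem log_card_loops_div_le (h : G.RowFinite) {ι : Type*} [Fintype ι] [Nonempty ι]
    {y : ι → G.InfPath} {e : E} {l : ℕ} (hl : 0 < l) (h0 : ∀ a, (y a).1 0 = e)
    (h1 : ∀ a, (y a).1 l = e) (hinj : ∀ a b, (∀ i < l, (y a).1 i = (y b).1 i) → a = b) :
    ((Real.log (Fintype.card ι) / l : ℝ) : EReal) ≤ G.topologicalEntropy h := by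
  let H : Set E := ⋃ a, (fun i => (y a).1 i) '' (Iio l)
  have hH : H.Finite := finite_iUnion fun a => (finite_Iio l).image _
  have hcov : DeaconuRenault.IsOpenCover
      ((fun f => {x : G.InfPath | x.1 0 ∈ ({f} : Set E)}) '' H) {x : G.InfPath | x.1 0 ∈ H} := by
    constructor
    · rintro _ ⟨f, -, rfl⟩
      exact G.isOpen_setOf_coord 0 {f}
    · exact fun x hx => ⟨_, ⟨x.1 0, hx, rfl⟩, rfl⟩
  refine le_trans ?_ ((G.shiftSystem h).entropyCover_le_topologicalEntropy
    (isCompact_setOf_coord_zero_mem h hH) hcov)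
  -- A lower bound along the multiples of `l` is enough for an upper limit.
  refine le_limsup_of_frequently_le' (frequently_atTop.2 fun N => ⟨(N + 1) * l, by nlinarith, ?_⟩)
  set k := N + 1
  obtain ⟨a₀⟩ := ‹Nonempty ι›
  -- The loop `a₀` only fills the tail after the `k` chosen blocks.
  let x : (Fin k → ι) → G.InfPath := fun w =>
    loopConcat hl h0 h1 fun t => if ht : t < k then w ⟨t, ht⟩ else a₀
  have hcard := card_le_coverNumber h (H := H) (n := k * l) x
    (fun w i _ => mem_iUnion.2 ⟨_, mem_image_of_mem _ (Nat.mod_lt i hl)⟩) (fun w w' hw => by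
      funext j
      refine hinj _ _ fun i hi => ?_
      have hij : j * l + i < k * l :=
        calc (j : ℕ) * l + i < j * l + l := by omega
          _ = (j + 1) * l := by ring
          _ ≤ k * l := Nat.mul_le_mul_right l j.2
      have hdiv : ((j : ℕ) * l + i) / l = j := by
        rw [mul_comm, Nat.mul_add_div hl, Nat.div_eq_of_lt hi, add_zero]
      have hmod : ((j : ℕ) * l + i) % l = i := by
        rw [mul_comm, Nat.mul_add_mod, Nat.mod_eq_of_lt hi]
      simpa [x, loopConcat, hdiv, hmod] using hw (j * l + i) hij.le)
  have hpos : 0 < Fintype.card ι := Fintype.card_pos_iff.2 ⟨a₀⟩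
  have hlog : ENNReal.log (((Fintype.card (Fin k → ι) : ℕ∞) : ℝ≥0∞))
      = ((k * Real.log (Fintype.card ι) : ℝ) : EReal) := by
    rw [ENNReal.log_pos_real (by simp) (by simp)]
    simp
  calc ((Real.log (Fintype.card ι) / l : ℝ) : EReal)
      = ((k * Real.log (Fintype.card ι) / (k * l : ℕ) : ℝ) : EReal) := by
        congr 1
        have : (l : ℝ) ≠ 0 := by positivity
        have : (k : ℝ) ≠ 0 := by positivity
        push_cast
        field_simp
    _ = ENNReal.log (((Fintype.card (Fin k → ι) : ℕ∞) : ℝ≥0∞)) / ((k * l : ℕ) : EReal) := by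
        rw [hlog, EReal.coe_div]
        rfl
    _ ≤ _ := by
        refine EReal.div_le_div_right_of_nonneg (by positivity) ?_
        rw [DeaconuRenault.coverH, ENNReal.log_le_log_iff]
        exact_mod_cast hcard

end DirectedGraph

noncomputable section

namespace DirectedGraph

variable {V E : Type*} {G : DirectedGraph V E}

/-! ### Counting the words seen through a finite set of edges -/

open scoped Classical in
/-- The first `n` edges of `x`, those outside `F` being blanked out. -/
def word (F : Finset E) (n : ℕ) (x : G.InfPath) (t : ℕ) : Option E :=
  if t < n ∧ x.1 t ∈ F then some (x.1 t) else none

theorem word_eq_of_lt {F : Finset E} {n m : ℕ} {x y : G.InfPath} {t : ℕ}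
    (h : word F n x = word F m y) (htn : t < n) (htm : t < m) {f : E} (hf : f ∈ F) :
    x.1 t = f ↔ y.1 t = f := by
  have := congrFun h t
  simp only [word] at this
  split_ifs at this with h1 h2 h2
  · rw [Option.some.inj this]
  · exact ⟨fun h' => absurd ⟨htn, h' ▸ hf⟩ h1, fun h' => absurd ⟨htm, h' ▸ hf⟩ h2⟩

theorem finite_range_word (F : Finset E) (n : ℕ) :
    (range (word F n : G.InfPath → ℕ → Option E)).Finite := by
  classical
  refine (finite_range fun (g : Fin n → Option F) (t : ℕ) =>
    if ht : t < n then (g ⟨t, ht⟩).map Subtype.val else none).subset ?_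
  rintro _ ⟨x, rfl⟩
  refine ⟨fun i => if hi : x.1 i ∈ F then some ⟨x.1 i, hi⟩ else none, funext fun t => ?_⟩
  by_cases ht : t < n <;> by_cases hx : x.1 t ∈ F <;> simp [word, ht, hx]

variable (G) in
/-- The words of length `n` seen through `F`. -/
def words (F : Finset E) (n : ℕ) : Finset (ℕ → Option E) :=
  (finite_range_word (G := G) F n).toFinset

theorem finite_image_word (F : Finset E) (n : ℕ) (A : Set G.InfPath) :
    (word F n '' A).Finite :=
  (finite_range_word F n).subset (image_subset_range _ _)

variable (G) in
/-- The words of length `l` seen through `F` along the loops of length `l` starting with `e`. -/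
def loopWords (F : Finset E) (e : E) (l : ℕ) : Finset (ℕ → Option E) :=
  (finite_image_word (G := G) F l {x | x.1 0 = e ∧ x.1 l = e}).toFinset

theorem word_mem_words (F : Finset E) (n : ℕ) (x : G.InfPath) : word F n x ∈ G.words F n := by
  simp [words]

theorem word_mem_loopWords (F : Finset E) {e : E} {l : ℕ} {x : G.InfPath} (h0 : x.1 0 = e)
    (h1 : x.1 l = e) : word F l x ∈ G.loopWords F e l := by
  simp only [loopWords, Finite.mem_toFinset]
  exact ⟨x, ⟨h0, h1⟩, rfl⟩

/-- One path is chosen per word. Distinct words force these paths to differ before time `l`, so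
`log_card_loops_div_le` applies, even though the loops may pass through edges outside `F`. -/
theorem card_loopWords_le (h : G.RowFinite) {c : ℝ} (hc : G.topologicalEntropy h ≤ c)
    (F : Finset E) (e : E) (l : ℕ) : ((G.loopWords F e l).card : ℝ) ≤ Real.exp (c * l) := by
  rcases (G.loopWords F e l).eq_empty_or_nonempty with hemp | hne
  · rw [hemp]
    simpa using (Real.exp_pos _).le
  have := hne.to_subtype
  -- Length `0` occurs when `e` is visited exactly once; it contributes only the blank word.
  rcases l.eq_zero_or_pos with rfl | hl
  · have : G.loopWords F e 0 ⊆ {fun _ => none} := by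
      intro w hw
      simp only [loopWords, Finite.mem_toFinset] at hw
      obtain ⟨x, -, rfl⟩ := hw
      simp [word, funext_iff]
    simpa using Finset.card_le_card this
  · have hex : ∀ w : G.loopWords F e l, ∃ x : G.InfPath, (x.1 0 = e ∧ x.1 l = e) ∧
        word F l x = w.1 := fun w =>
      (Finite.mem_toFinset (finite_image_word F l {x : G.InfPath | x.1 0 = e ∧ x.1 l = e})).1 w.2
    choose y hy hyw using hex
    have hlog := (log_card_loops_div_le h hl (fun a => (hy a).1) (fun a => (hy a).2)
      (fun a b hab => Subtype.ext (by
        rw [← hyw, ← hyw]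
        funext t
        by_cases ht : t < l
        · simp only [word]
          rw [hab t ht]
        · simp [word, ht]))).trans hc
    rw [EReal.coe_le_coe_iff, div_le_iff₀ (by positivity), Fintype.card_coe] at hlog
    rwa [← Real.log_le_iff_le_exp (by exact_mod_cast hne.card_pos)]

open scoped Classical in
-- Here `i` and `j` are the first and last visits to `e` before time `n`. The pieces before `i` and
-- after `j` avoid `e`, so they are words through `F.erase e`; between them lie a loop of length `j
-- - i` and the single letter at `j`. The first term of the union collects the paths without a
-- visit.
theorem words_subset (F : Finset E) (e : E) (n : ℕ) :
    G.words F n ⊆ G.words (F.erase e) n ∪ (Finset.range n).biUnion fun j =>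
      (Finset.range (j + 1)).biUnion fun i =>
        (G.words (F.erase e) i ×ˢ G.loopWords F e (j - i) ×ˢ G.words (F.erase e) (n - (j + 1))).image
          fun u t => if t < i then u.1 t else if t < j then u.2.1 (t - i) else
            if t = j then (if e ∈ F then some e else none) else u.2.2 (t - (j + 1)) := by
  intro w hw
  simp only [words, Finite.mem_toFinset] at hw
  obtain ⟨x, rfl⟩ := hw
  by_cases hex : ∃ t < n, x.1 t = e
  · refine Finset.mem_union_right _ ?_
    let T := (Finset.range n).filter fun t => x.1 t = e
    have hT : T.Nonempty := by
      obtain ⟨t, ht, hxt⟩ := hex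
      exact ⟨t, by simp [T, ht, hxt]⟩
    have hmem : ∀ t, t ∈ T ↔ t < n ∧ x.1 t = e := by simp [T]
    obtain ⟨-, hi⟩ := (hmem _).1 (T.min'_mem hT)
    obtain ⟨hjn, hj⟩ := (hmem _).1 (T.max'_mem hT)
    have hmin : ∀ t < T.min' hT, t < n → x.1 t ≠ e := fun t ht htn hxt =>
      ht.not_ge (T.min'_le t ((hmem t).2 ⟨htn, hxt⟩))
    have hmax : ∀ t > T.max' hT, t < n → x.1 t ≠ e := fun t ht htn hxt =>
      ht.not_ge (T.le_max' t ((hmem t).2 ⟨htn, hxt⟩))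
    have hij := T.min'_le _ (T.max'_mem hT)
    generalize T.min' hT = i at *
    generalize T.max' hT = j at *
    simp only [Finset.mem_biUnion, Finset.mem_range, Finset.mem_image, Finset.mem_product]
    refine ⟨j, hjn, i, by omega, (word (F.erase e) i x, word F (j - i) (G.shift^[i] x),
      word (F.erase e) (n - (j + 1)) (G.shift^[j + 1] x)), ⟨word_mem_words _ _ _,
      word_mem_loopWords _ ?_ ?_, word_mem_words _ _ _⟩, funext fun t => ?_⟩
    · rwa [shift_iterate_apply, zero_add]
    · rwa [shift_iterate_apply, Nat.sub_add_cancel hij]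
    · simp only [word, shift_iterate_apply, Finset.mem_erase]
      generalize x.1 = z at *
      grind
  · refine Finset.mem_union_left _ ?_
    push Not at hex
    convert word_mem_words (F.erase e) n x using 1
    funext t
    simp only [word, Finset.mem_erase]
    grind

/-- The lengths of the three pieces add up to less than `n`, so the exponential rate stays `c` and
each new edge only raises the polynomial degree. -/
theorem card_words_le (h : G.RowFinite) {c : ℝ} (hc₀ : 0 ≤ c) (hc : G.topologicalEntropy h ≤ c)
    (F : Finset E) :
    ∃ D : ℕ, ∀ n : ℕ, ((G.words F n).card : ℝ) ≤ (n + 2) ^ D * Real.exp (c * n) := by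
  classical
  induction F using Finset.induction_on with
  | empty =>
    refine ⟨0, fun n => ?_⟩
    have : G.words ∅ n ⊆ {fun _ => none} := by
      intro w hw
      simp only [words, Finite.mem_toFinset] at hw
      obtain ⟨x, rfl⟩ := hw
      simp [word, funext_iff]
    have h1 : ((G.words ∅ n).card : ℝ) ≤ 1 := by
      exact_mod_cast (Finset.card_le_card this).trans_eq (Finset.card_singleton _)
    simpa using h1.trans (Real.one_le_exp (by positivity))
  | insert e F he ih =>
    obtain ⟨D, hD⟩ := ih
    -- The two end pieces contribute degree `D` each, and the at most `n ^ 2` pairs `(i, j)`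
    -- contribute `2`. Words without `e` are absorbed by `1 + n ^ 2 ≤ (n + 2) ^ 2`.
    refine ⟨2 * D + 2, fun n => ?_⟩
    have hsub := words_subset (G := G) (insert e F) e n
    rw [Finset.erase_insert he] at hsub
    have hcard := (Finset.card_le_card hsub).trans (Finset.card_union_le _ _)
    have hterm : ∀ j < n, ∀ i < j + 1, (((G.words F i ×ˢ G.loopWords (insert e F) e (j - i) ×ˢ
        G.words F (n - (j + 1))).card : ℕ) : ℝ) ≤ ((n : ℝ) + 2) ^ (2 * D) * Real.exp (c * n) := by
      intro j hj i hi
      have hle : ∀ m ≤ n, ((G.words F m).card : ℝ) ≤ ((n : ℝ) + 2) ^ D * Real.exp (c * m) :=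
        fun m hm => (hD m).trans (by gcongr)
      have hexp : Real.exp (c * i) * Real.exp (c * (j - i : ℕ)) * Real.exp (c * (n - (j + 1) : ℕ))
          ≤ Real.exp (c * n) := by
        rw [← Real.exp_add, ← Real.exp_add, ← mul_add, ← mul_add, Real.exp_le_exp]
        refine mul_le_mul_of_nonneg_left ?_ hc₀
        exact_mod_cast (by omega : i + (j - i) + (n - (j + 1)) ≤ n)
      rw [Finset.card_product, Finset.card_product]
      push_cast
      calc _ ≤ (((n : ℝ) + 2) ^ D * Real.exp (c * i)) * (Real.exp (c * (j - i : ℕ)) *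
            (((n : ℝ) + 2) ^ D * Real.exp (c * (n - (j + 1) : ℕ)))) := by
            gcongr
            · exact hle i (by omega)
            · exact card_loopWords_le h hc _ _ _
            · exact hle _ (by omega)
        _ = ((n : ℝ) + 2) ^ (2 * D) * (Real.exp (c * i) * Real.exp (c * (j - i : ℕ)) *
            Real.exp (c * (n - (j + 1) : ℕ))) := by ring
        _ ≤ _ := by gcongr
    have hsum : ((∑ j ∈ Finset.range n, ∑ i ∈ Finset.range (j + 1), ((G.words F i ×ˢ
        G.loopWords (insert e F) e (j - i) ×ˢ G.words F (n - (j + 1))).card : ℕ) : ℕ) : ℝ)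
        ≤ n * (n * (((n : ℝ) + 2) ^ (2 * D) * Real.exp (c * n))) := by
      push_cast only [Nat.cast_sum]
      have : ∀ j ∈ Finset.range n, ∑ i ∈ Finset.range (j + 1), (((G.words F i ×ˢ
          G.loopWords (insert e F) e (j - i) ×ˢ G.words F (n - (j + 1))).card : ℕ) : ℝ)
          ≤ n * (((n : ℝ) + 2) ^ (2 * D) * Real.exp (c * n)) := fun j hj => by
        rw [Finset.mem_range] at hj
        refine (Finset.sum_le_card_nsmul _ _ _ fun i hi =>
          hterm j hj i (Finset.mem_range.1 hi)).trans ?_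
        rw [Finset.card_range, nsmul_eq_mul]
        gcongr
        exact hj
      refine (Finset.sum_le_card_nsmul _ _ _ this).trans_eq ?_
      rw [Finset.card_range, nsmul_eq_mul]
    have hunion := Finset.card_biUnion_le.trans (Finset.sum_le_sum fun j (_ : j ∈ Finset.range n) =>
      Finset.card_biUnion_le.trans (Finset.sum_le_sum fun i (_ : i ∈ Finset.range (j + 1)) =>
        Finset.card_image_le
          (s := G.words F i ×ˢ G.loopWords (insert e F) e (j - i) ×ˢ G.words F (n - (j + 1)))
          (f := fun u t => if t < i then u.1 t else if t < j then u.2.1 (t - i) else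
            if t = j then (if e ∈ insert e F then some e else none) else u.2.2 (t - (j + 1)))))
    have htot : ((G.words (insert e F) n).card : ℝ) ≤ ((n : ℝ) + 2) ^ D * Real.exp (c * n)
        + n * (n * (((n : ℝ) + 2) ^ (2 * D) * Real.exp (c * n))) := by
      refine le_trans ?_ (add_le_add (hD n) hsum)
      exact_mod_cast hcard.trans (Nat.add_le_add_left hunion _)
    have hpow : ((n : ℝ) + 2) ^ D ≤ ((n : ℝ) + 2) ^ (2 * D) :=
      pow_le_pow_right₀ (by linarith [n.cast_nonneg (α := ℝ)]) (by omega)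
    have hexp := Real.exp_pos (c * n)
    have hn : (0 : ℝ) ≤ n := n.cast_nonneg
    calc _ ≤ _ := htot
      _ ≤ ((n : ℝ) + 2) ^ (2 * D) * Real.exp (c * n)
        + n * (n * (((n : ℝ) + 2) ^ (2 * D) * Real.exp (c * n))) := by gcongr
      _ = (1 + (n : ℝ) ^ 2) * (((n : ℝ) + 2) ^ (2 * D) * Real.exp (c * n)) := by ring
      _ ≤ ((n : ℝ) + 2) ^ 2 * (((n : ℝ) + 2) ^ (2 * D) * Real.exp (c * n)) := by
        gcongr
        nlinarith
      _ = _ := by ring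

/-! ### Separated sets -/

/-- A generalized vertex is a finite set of vertices, so by row-finiteness only finitely many first
edges start in it. A path of positive length involves only its own edges. -/
theorem exists_isInitial_iff_of_word (h : G.RowFinite) (q : G.FinPath) :
    ∃ (F : Finset E) (k : ℕ), ∀ x y : G.InfPath,
      (∀ i < k, ∀ f ∈ F, (x.1 i = f ↔ y.1 i = f)) → (q.IsInitial x ↔ q.IsInitial y) := by
  classical
  cases q with
  | vertices A hA =>
    have hfin : {e | G.s e ∈ A}.Finite := by
      have : {e | G.s e ∈ A} = ⋃ v ∈ A, {e | G.s e = v} := by ext; simp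
      rw [this]
      exact hA.finite.biUnion fun v _ => h v
    refine ⟨hfin.toFinset, 1, fun x y hxy => ?_⟩
    simp only [FinPath.IsInitial, Finite.mem_toFinset, mem_ofPred_eq] at hxy ⊢
    exact ⟨fun hx => by rwa [(hxy 0 one_pos _ hx).1 rfl], fun hy => by
      rwa [(hxy 0 one_pos _ hy).2 rfl]⟩
  | edges l hne hl =>
    refine ⟨l.toFinset, l.length, fun x y hxy => ?_⟩
    have hiff : ∀ z : G.InfPath, (FinPath.edges l hne hl).IsInitial z ↔
        ∀ i (hi : i < l.length), z.1 i = l[i] := fun z => by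
      change l = List.ofFn (fun i : Fin l.length => z.1 i) ↔ _
      rw [List.ext_getElem_iff]
      simp [eq_comm]
    rw [hiff, hiff]
    exact forall₂_congr fun i hi => hxy i hi _ (by simp)

theorem exists_forall_isInitial_iff_of_word (h : G.RowFinite) (p : ℕ → G.FinPath) (N : ℕ) :
    ∃ (F : Finset E) (k : ℕ), ∀ x y : G.InfPath,
      (∀ i < k, ∀ f ∈ F, (x.1 i = f ↔ y.1 i = f)) →
        ∀ j < N, ((p j).IsInitial x ↔ (p j).IsInitial y) := by
  classical
  choose F k hFk using fun j => exists_isInitial_iff_of_word h (p j)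
  refine ⟨(Finset.range N).biUnion F, (Finset.range N).sup k, fun x y hxy j hj => ?_⟩
  have hj' := Finset.mem_range.2 hj
  exact hFk j x y fun i hi f hf => hxy i (hi.trans_le (Finset.le_sup (f := k) hj')) f
    (Finset.mem_biUnion.2 ⟨j, hj', hf⟩)

/-- If `(1 / 2) ^ N < ε`, separation at some time `i < n` is detected by one of the first `N` finite
paths, hence by the edges of `F` at times `i, …, i + k - 1`. Thus `word F (n + k)` is injective on
separated sets, with `F` and `k` depending on `ε` but not on `n` or `K`. -/
theorem exists_ssep_le_card_words (h : G.RowFinite) (p : ℕ ≃ G.FinPath) {ε : ℝ} (hε : 0 < ε) :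
    ∃ (F : Finset E) (k : ℕ), ∀ (n : ℕ) (K : Set G.InfPath),
      @DeaconuRenault.ssep _ (G.pathMetric p) (G.shiftSystem h) n ε K
        ≤ (G.words F (n + k)).card := by
  obtain ⟨N, hN⟩ := exists_pow_lt_of_lt_one hε (by norm_num : (1 / 2 : ℝ) < 1)
  obtain ⟨F, k, hFk⟩ := exists_forall_isInitial_iff_of_word h p N
  refine ⟨F, k, fun n K => ?_⟩
  let _ : MetricSpace G.InfPath := G.pathMetric p
  refine (G.shiftSystem h).ssep_le fun A hA => ?_
  rw [← encard_coe_eq_coe_finsetCard]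
  refine encard_le_encard_of_injOn (f := word F (n + k)) (fun x _ => word_mem_words F _ x) ?_
  intro x hx y hy hxy
  by_contra hne
  obtain ⟨i, hi, hlt⟩ := ((G.shiftSystem h).lt_iterDist_iff rfl hε.le).1 (hA.2 x hx y hy hne)
  change ε < G.pathDist p (G.shift^[i] x) (G.shift^[i] y) at hlt
  refine (hN.trans hlt).not_gt ((pathDist_lt_iff p _ _ N).2 (hFk _ _ fun t ht f hf => ?_))
  rw [shift_iterate_apply, shift_iterate_apply]
  exact word_eq_of_lt hxy (by omega) (by omega) hf

theorem tendsto_log_add_two_div_atTop (k : ℕ) :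
    Tendsto (fun n : ℕ => Real.log ((n + k : ℕ) + 2) / n) atTop (𝓝 0) := by
  have hO : (id ∘ Nat.cast ∘ fun n : ℕ => n + (k + 2) : ℕ → ℝ) =O[atTop]
      fun n : ℕ => (n : ℝ) := by
    refine Asymptotics.IsBigO.of_bound (k + 3) ?_
    filter_upwards [eventually_ge_atTop 1] with n hn
    have hn' : (1 : ℝ) ≤ n := by exact_mod_cast hn
    simp only [Function.comp_apply, id, Real.norm_natCast]
    push_cast
    nlinarith [k.cast_nonneg (α := ℝ)]
  have h := (Real.isLittleO_log_id_atTop.comp_tendsto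
      (tendsto_natCast_atTop_atTop.comp (tendsto_add_atTop_nat (k + 2)))).trans_isBigO hO
  refine h.tendsto_div_nhds_zero.congr fun n => ?_
  simp only [Function.comp_apply]
  push_cast
  rw [add_assoc]

theorem metricEntropy_le_topologicalEntropy (h : G.RowFinite) (p : ℕ ≃ G.FinPath) :
    G.metricEntropy h p ≤ G.topologicalEntropy h := by
  rcases eq_or_ne (G.topologicalEntropy h) ⊤ with htop | htop
  · rw [htop]
    exact le_top
  have hnonneg : 0 ≤ G.topologicalEntropy h := (G.shiftSystem h).topologicalEntropy_nonneg
  lift G.topologicalEntropy h to ℝ using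
    ⟨htop, ((EReal.bot_lt_zero).trans_le hnonneg).ne'⟩ with c hc
  have hc₀ : 0 ≤ c := EReal.coe_nonneg.1 hnonneg
  refine iSup₂_le fun K _ => iSup₂_le fun ε hε => ?_
  obtain ⟨F, k, hFk⟩ := exists_ssep_le_card_words h p hε
  obtain ⟨D, hD⟩ := card_words_le h hc₀ hc.ge F
  refine EReal.limsup_div_le_of_eventually_le
    (a := fun n => D * Real.log ((n + k : ℕ) + 2) + c * (n + k : ℕ))
    (Eventually.of_forall fun n => ?_) ?_
  · calc _ ≤ ENNReal.log (((G.words F (n + k)).card : ℕ∞) : ℝ≥0∞) := by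
          rw [ENNReal.log_le_log_iff]
          exact_mod_cast hFk n K
      _ ≤ ENNReal.log (ENNReal.ofReal (((n + k : ℕ) + 2) ^ D * Real.exp (c * (n + k : ℕ)))) := by
          rw [ENNReal.log_le_log_iff, ENat.toENNReal_coe,
            ← ENNReal.ofReal_natCast]
          exact ENNReal.ofReal_le_ofReal (hD (n + k))
      _ = _ := by
          rw [ENNReal.log_ofReal_of_pos (by positivity), Real.log_mul (by positivity)
            (by positivity), Real.log_pow, Real.log_exp]
  · have h1 := (tendsto_log_add_two_div_atTop k).const_mul (D : ℝ)
    have h2 : Tendsto (fun n : ℕ => c * (1 + k / (n : ℝ))) atTop (𝓝 (c * (1 + 0))) :=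
      (tendsto_const_nhds.add (tendsto_const_div_atTop_nhds_zero_nat (k : ℝ))).const_mul c
    have h3 := h1.add h2
    simp only [mul_zero, add_zero, zero_add, mul_one] at h3
    refine h3.congr' ?_
    filter_upwards [eventually_gt_atTop 0] with n hn
    have : (n : ℝ) ≠ 0 := by positivity
    push_cast
    field_simp

end DirectedGraph

end

open DirectedGraph in
theorem mainTheorem6 {V E : Type*} (G : DirectedGraph V E) (hs : G.NoSinks)
    (hG : G.LocallyFinite) (p : ℕ ≃ G.FinPath) :
    G.metricEntropy hG.rowFinite p = G.topologicalEntropy hG.rowFinite := by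
  refine le_antisymm (metricEntropy_le_topologicalEntropy hG.rowFinite p) ?_
  -- An enumeration indexed by `ℕ` already provides a finite path, so the graph has a vertex.
  have := G.nonempty_of_finPath (p 0)
  have := hs.nonempty_infPath
  let _ : MetricSpace G.InfPath := G.pathMetric p
  exact (G.shiftSystem hG.rowFinite).topologicalEntropy_le_metricEntropy rfl
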